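/- **Theorem 3.9.** Let $A$ be a unital ring, let $S$ be a cancellative left Ore monoid (any two elements have a common left multiple) with enveloping group $G=S^{-1}S$, and let $\alpha\colon S\to \mathrm{Endr}(A)$ be an action of $S$ on $A$ by not necessarily unital ring endomorphisms. Put $I=\bigcup_{s\in S}\ker\alpha_s$, an ideal of $A$, and let $\alpha'$ be the induced action of $S$ on $A/I$. Notation. For an action $\beta$ of $S$ on a unital ring $C$ by not necessarily unital endomorphisms, $S^{\mathrm{op}}*_\beta C*_\beta S$ is the universal unital ring with a unital ring homomorphism $\phi$ from $C$ and monoid homomorphisms $s\mapsto s_-$ from $S^{\mathrm{op}}$ and $s\mapsto s_+$ from $S$ such that $s_+\phi(c)=\phi(\beta_s(c))s_+$, $\phi(c)s_-=s_-\phi(\beta_s(c))$, $s_-s_+=1$ and $s_+s_-=\phi(\beta_s(1))$; its component of degree $x\in G$ is $\bigcup_{s^{-1}t=x}s_-\phi(C)t_+$. Let $B=S_-(A/I)S_+=\{s_-\phi(a)s_+ : s\in S,\ a\in A/I\}$, a unital subring of $S^{\mathrm{op}}*_{\alpha'}(A/I)*_{\alpha'}S$ on which $S$ acts by $\overline\alpha_s(x)=s_+xs_-$.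 Let $S^{-1}B$ be the not necessarily unital ring of classes $[s,b]$ of pairs in $S\times B$, where $[s_1,b_1]=[s_2,b_2]$ if and only if there are $t_1,t_2\in S$ with $t_1s_1=t_2s_2$ and $\overline\alpha_{t_1}(b_1)=\overline\alpha_{t_2}(b_2)$, with operations $[s_1,b_1]+[s_2,b_2]=[t_1s_1,\overline\alpha_{t_1}(b_1)+\overline\alpha_{t_2}(b_2)]$ and $[s_1,b_1][s_2,b_2]=[t_1s_1,\overline\alpha_{t_1}(b_1)\overline\alpha_{t_2}(b_2)]$ for any $t_1s_1=t_2s_2$. Let $j\colon A\to S^{-1}B$, $j(a)=[1,\phi(a+I)]$. Then: 1. $j$ has kernel $I$, and $\alpha$ extends to an action $\widehat\alpha$ of $G$ on $S^{-1}B$ by ring automorphisms, that is, $\widehat\alpha_s(j(a))=j(\alpha_s(a))$ for all $s\in S$, $a\in A$. 2. There is an idempotent $e\in S^{-1}B$, nonzero if $I\ne A$, such that $\widehat\alpha_s(e)\le e$ for all $s\in S$ (meaning $\widehat\alpha_s(e)=e\,\widehat\alpha_s(e)=\widehat\alpha_s(e)\,e$), and $$S^{\mathrm{op}}*_\alpha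 A*_\alpha S\;\cong\; e\bigl((S^{-1}B)*_{\widehat\alpha}G\bigr)e$$ as $G$-graded rings, where $(S^{-1}B)*_{\widehat\alpha}G$ is the skew group ring of finite formal sums $\sum_g c_g g$ with product $(cg)(dh)=c\,\widehat\alpha_g(d)\,gh$, $e$ is identified with $e\cdot 1_G$, and the component of degree $g$ of the corner is its intersection with $(S^{-1}B)g$. In particular the two families of components are $G$-gradings of these rings. -/

import Mathlib

namespace FracSkew

noncomputable section

open OreLocalization

universe u v w

/-! ### Left Ore monoids and the enveloping group -/

section Env

/-- The left Ore condition: any two elements have a common left multiple. -/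
theorem ore {S : Type v} [Monoid S] [OreSet (⊤ : Submonoid S)] (s t : S) : ∃ a b : S, a * s = b * t :=
  ⟨oreDenom s (⟨t, trivial⟩ : (⊤ : Submonoid S)), oreNum s (⟨t, trivial⟩ : (⊤ : Submonoid S)),
    ore_eq s (⟨t, trivial⟩ : (⊤ : Submonoid S))⟩

theorem act_mul {B : Type u} [NonUnitalRing B] {S : Type v} [Monoid S]
    (β : S →* (B →ₙ+* B)) (s t : S) (a : B) : β (s * t) a = β s (β t a) := by
  rw [map_mul]; rfl

theorem act_one {B : Type u} [NonUnitalRing B] {S : Type v} [Monoid S]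
    (β : S →* (B →ₙ+* B)) (a : B) : β 1 a = a := by
  rw [map_one]; rfl

theorem isUnit_env {S : Type v} [Monoid S] [OreSet (⊤ : Submonoid S)]
    (x : OreLocalization (⊤ : Submonoid S) S) : IsUnit x := by
  induction x using OreLocalization.ind with
  | _ r s =>
    let r' : (⊤ : Submonoid S) := ⟨r, trivial⟩
    exact ⟨⟨(r' : S) /ₒ s, (s : S) /ₒ r', OreLocalization.mul_inv r' s,
      OreLocalization.mul_inv s r'⟩, rfl⟩

variable {S : Type v} [Monoid S] [IsCancelMul S] [OreSet (⊤ : Submonoid S)]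

variable (S) in
/-- The enveloping group `G = S⁻¹S`: the Ore localization of the cancellative left Ore monoid `S`
at all of its elements. -/
def EnvelopingGroup : Type v := OreLocalization (⊤ : Submonoid S) S

/-- The natural map `S → G = S⁻¹S`, as a monoid homomorphism into the Ore localization. -/
def envPre (S : Type v) [Monoid S] [OreSet (⊤ : Submonoid S)] :
    S →* OreLocalization (⊤ : Submonoid S) S := numeratorHom

/-- The group structure extends the multiplication of the Ore localization. -/
instance : Group (EnvelopingGroup S) :=
  @groupOfIsUnit _ (inferInstanceAs (Monoid (OreLocalization (⊤ : Submonoid S) S))) isUnit_env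

/-- The natural map `S → G = S⁻¹S`. -/
def toEnv : S →* EnvelopingGroup S where
  toFun s := envPre S s
  map_one' := map_one (envPre S)
  map_mul' := map_mul (envPre S)

theorem toEnv_injective : Function.Injective (toEnv : S → EnvelopingGroup S) := by
  intro a b h
  obtain ⟨c, d, h1, h2⟩ := oreDiv_eq_iff.mp (show a /ₒ (1 : (⊤ : Submonoid S)) = b /ₒ 1 from h)
  simp only [OneMemClass.coe_one, mul_one] at h2
  have h3 : (c : S) * b = d * a := h1
  rw [← h2] at h3
  exact (mul_left_cancel h3).symm

/-- Every element of the enveloping group is a left fraction. -/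
theorem exists_frac (x : EnvelopingGroup S) : ∃ s t : S, (toEnv s)⁻¹ * toEnv t = x := by
  induction x using OreLocalization.ind with
  | _ r s =>
    refine ⟨s, r, inv_mul_eq_iff_eq_mul.mpr ?_⟩
    exact (OreLocalization.mul_cancel (r := r) (s := s) (t := 1)).symm

end Env

/-! ### The fractional skew monoid ring -/

section FSMR

variable {A : Type u} [Ring A] {S : Type v} [Monoid S] (α : S →* (A →ₙ+* A))

variable (A S) in
/-- Generators of the fractional skew monoid ring: symbols `φ(a)`, `s₋`, `s₊`. -/
inductive Gen : Type (max u v)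
  | coef (a : A) : Gen
  | minus (s : S) : Gen
  | plus (s : S) : Gen

/-- Defining relations of the fractional skew monoid ring: `φ` is a unital ring homomorphism,
`s ↦ s₋` is a homomorphism from the opposite monoid, `s ↦ s₊` is a homomorphism, and the four
commutation relations hold. -/
inductive Rel : FreeAlgebra ℤ (Gen A S) → FreeAlgebra ℤ (Gen A S) → Prop
  | coef_one : Rel (FreeAlgebra.ι ℤ (.coef 1)) 1
  | coef_add (a b : A) : Rel (FreeAlgebra.ι ℤ (.coef (a + b)))
      (FreeAlgebra.ι ℤ (.coef a) + FreeAlgebra.ι ℤ (.coef b))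
  | coef_mul (a b : A) : Rel (FreeAlgebra.ι ℤ (.coef (a * b)))
      (FreeAlgebra.ι ℤ (.coef a) * FreeAlgebra.ι ℤ (.coef b))
  | minus_one : Rel (FreeAlgebra.ι ℤ (.minus 1)) 1
  | minus_mul (s t : S) : Rel (FreeAlgebra.ι ℤ (.minus (s * t)))
      (FreeAlgebra.ι ℤ (.minus t) * FreeAlgebra.ι ℤ (.minus s))
  | plus_one : Rel (FreeAlgebra.ι ℤ (.plus 1)) 1
  | plus_mul (s t : S) : Rel (FreeAlgebra.ι ℤ (.plus (s * t)))
      (FreeAlgebra.ι ℤ (.plus s) * FreeAlgebra.ι ℤ (.plus t))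
  | plus_coef (t : S) (a : A) :
      Rel (FreeAlgebra.ι ℤ (.plus t) * FreeAlgebra.ι ℤ (.coef a))
        (FreeAlgebra.ι ℤ (.coef (α t a)) * FreeAlgebra.ι ℤ (.plus t))
  | coef_minus (s : S) (a : A) :
      Rel (FreeAlgebra.ι ℤ (.coef a) * FreeAlgebra.ι ℤ (.minus s))
        (FreeAlgebra.ι ℤ (.minus s) * FreeAlgebra.ι ℤ (.coef (α s a)))
  | minus_plus (s : S) : Rel (FreeAlgebra.ι ℤ (.minus s) * FreeAlgebra.ι ℤ (.plus s)) 1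
  | plus_minus (s : S) : Rel (FreeAlgebra.ι ℤ (.plus s) * FreeAlgebra.ι ℤ (.minus s))
      (FreeAlgebra.ι ℤ (.coef (α s 1)))

/-- The fractional skew monoid ring `S^op *_α A *_α S`: the universal unital ring with a unital
ring homomorphism `φ` from `A` and monoid homomorphisms `s ↦ s₋` from `S^op` and `s ↦ s₊` from `S`
subject to `t₊ φ(a) = φ(α_t a) t₊`, `φ(a) s₋ = s₋ φ(α_s a)`, `s₋ s₊ = 1`, `s₊ s₋ = φ(α_s 1)`. -/
def FSMR : Type (max u v) := RingQuot (Rel α)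

instance : Ring (FSMR α) := inferInstanceAs (Ring (RingQuot (Rel α)))

/-- The quotient map. -/
def quo : FreeAlgebra ℤ (Gen A S) →+* FSMR α := RingQuot.mkRingHom (Rel α)

theorem quo_rel {x y : FreeAlgebra ℤ (Gen A S)} (h : Rel α x y) : quo α x = quo α y :=
  RingQuot.mkRingHom_rel h

/-- The class of a generator. -/
def gen (x : Gen A S) : FSMR α := quo α (FreeAlgebra.ι ℤ x)

/-- The structure homomorphism `φ : A → S^op *_α A *_α S`. -/
def phi : A →+* FSMR α where
  toFun a := gen α (.coef a)
  map_one' := by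
    simpa only [gen, map_one] using quo_rel α (Rel.coef_one (α := α))
  map_mul' a b := by
    simpa only [gen, map_mul] using quo_rel α (Rel.coef_mul (α := α) a b)
  map_zero' := by
    have h := quo_rel α (Rel.coef_add (α := α) 0 0)
    rw [add_zero, map_add] at h
    exact left_eq_add.mp h
  map_add' a b := by
    simpa only [gen, map_add] using quo_rel α (Rel.coef_add (α := α) a b)

/-- The element `s₋`. -/
def sm (s : S) : FSMR α := gen α (.minus s)

/-- The element `s₊`. -/
def sp (s : S) : FSMR α := gen α (.plus s)

theorem sm_one : sm α (1 : S) = 1 := by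
  simpa only [sm, gen, map_one] using quo_rel α (Rel.minus_one (α := α))

theorem sp_one : sp α (1 : S) = 1 := by
  simpa only [sp, gen, map_one] using quo_rel α (Rel.plus_one (α := α))

theorem sm_mul (s t : S) : sm α (s * t) = sm α t * sm α s := by
  simpa only [sm, gen, map_mul] using quo_rel α (Rel.minus_mul (α := α) s t)

theorem sp_mul (s t : S) : sp α (s * t) = sp α s * sp α t := by
  simpa only [sp, gen, map_mul] using quo_rel α (Rel.plus_mul (α := α) s t)

theorem sp_phi (t : S) (a : A) : sp α t * phi α a = phi α (α t a) * sp α t := by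
  have h := quo_rel α (Rel.plus_coef (α := α) t a)
  rw [map_mul, map_mul] at h
  exact h

theorem phi_sm (s : S) (a : A) : phi α a * sm α s = sm α s * phi α (α s a) := by
  have h := quo_rel α (Rel.coef_minus (α := α) s a)
  rw [map_mul, map_mul] at h
  exact h

theorem sm_sp (s : S) : sm α s * sp α s = 1 := by
  have h := quo_rel α (Rel.minus_plus (α := α) s)
  rw [map_mul, map_one] at h
  exact h

theorem sp_sm (s : S) : sp α s * sm α s = phi α (α s 1) := by
  have h := quo_rel α (Rel.plus_minus (α := α) s)
  rw [map_mul] at h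
  exact h

/-- The universal property of the fractional skew monoid ring. -/
theorem existsUnique_lift {R : Type w} [Ring R] (f : A →+* R) (m : Sᵐᵒᵖ →* R) (p : S →* R)
    (h1 : ∀ (t : S) (a : A), p t * f a = f (α t a) * p t)
    (h2 : ∀ (s : S) (a : A), f a * m (.op s) = m (.op s) * f (α s a))
    (h3 : ∀ s : S, m (.op s) * p s = 1) (h4 : ∀ s : S, p s * m (.op s) = f (α s 1)) :
    ∃! F : FSMR α →+* R, (∀ a, F (phi α a) = f a) ∧ (∀ s, F (sm α s) = m (.op s)) ∧
      ∀ s, F (sp α s) = p s := by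
  let g : Gen A S → R := fun x => match x with
    | .coef a => f a
    | .minus s => m (.op s)
    | .plus s => p s
  have hg : ∀ x, FreeAlgebra.lift ℤ g (FreeAlgebra.ι ℤ x) = g x :=
    fun x => FreeAlgebra.lift_ι_apply g x
  have hr : ∀ ⦃x y⦄, Rel α x y →
      (FreeAlgebra.lift ℤ g : _ →+* R) x = (FreeAlgebra.lift ℤ g : _ →+* R) y := by
    intro x y h
    cases h <;> simp [hg, g, h1, h2, h3, h4]
  refine ⟨RingQuot.lift ⟨_, hr⟩, ⟨fun a => ?_, fun s => ?_, fun s => ?_⟩, ?_⟩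
  · exact (RingQuot.lift_mkRingHom_apply _ hr _).trans (hg _)
  · exact (RingQuot.lift_mkRingHom_apply _ hr _).trans (hg _)
  · exact (RingQuot.lift_mkRingHom_apply _ hr _).trans (hg _)
  · rintro F ⟨ha, hm, hp⟩
    refine RingQuot.ringQuot_ext _ _ ?_
    have : ∀ F' : FreeAlgebra ℤ (Gen A S) →+* R, (∀ x, F' (FreeAlgebra.ι ℤ x) = g x) →
        F' = (FreeAlgebra.lift ℤ g : _ →+* R) := by
      intro F' hF'
      have h5 : F'.toIntAlgHom = FreeAlgebra.lift ℤ g :=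
        FreeAlgebra.hom_ext (funext fun x => (hF' x).trans (hg x).symm)
      exact RingHom.ext fun x => DFunLike.congr_fun h5 x
    have h6 := this (F.comp (quo α)) (by
      rintro (a | s | s)
      exacts [ha a, hm s, hp s])
    refine Eq.trans h6 (RingHom.ext fun x => ?_)
    exact (RingQuot.lift_mkRingHom_apply _ hr _).symm

theorem phi_p_sp (s : S) : phi α (α s 1) * sp α s = sp α s := by
  rw [← sp_sm, mul_assoc, sm_sp, mul_one]

theorem sm_phi_p (s : S) : sm α s * phi α (α s 1) = sm α s := by
  rw [← sp_sm, ← mul_assoc, sm_sp, one_mul]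

/-- `s₊ φ(a) s₋ = φ(α_s a)`. -/
theorem sp_phi_sm (s : S) (a : A) : sp α s * phi α a * sm α s = phi α (α s a) := by
  rw [sp_phi, mul_assoc, sp_sm, ← map_mul, ← map_mul, mul_one]

/-- Expanding a fraction. -/
theorem expand (c s t : S) (a : A) :
    sm α s * phi α a * sp α t = sm α (c * s) * phi α (α c a) * sp α (c * t) := by
  rw [sm_mul, sp_mul, ← sp_phi_sm]
  calc sm α s * phi α a * sp α t
      = sm α s * (sm α c * sp α c) * phi α a * (sm α c * sp α c) * sp α t := by
        rw [sm_sp, mul_one, mul_one]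
    _ = _ := by simp only [mul_assoc]

end FSMR

/-! ### The grading of the fractional skew monoid ring by the enveloping group -/

section Grading

variable {A : Type u} [Ring A] {S : Type v} [Monoid S] [IsCancelMul S]
  [OreSet (⊤ : Submonoid S)] (α : S →* (A →ₙ+* A))

/-- The component of degree `x ∈ G = S⁻¹S`, namely `⋃_{s⁻¹t = x} s₋ φ(A) t₊`. -/
def component (x : EnvelopingGroup S) : AddSubgroup (FSMR α) where
  carrier := {r | ∃ (s t : S) (a : A), (toEnv s)⁻¹ * toEnv t = x ∧
    r = sm α s * phi α a * sp α t}
  zero_mem' := by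
    obtain ⟨s, t, h⟩ := exists_frac x
    exact ⟨s, t, 0, h, by simp⟩
  neg_mem' := by
    rintro _ ⟨s, t, a, h, rfl⟩
    exact ⟨s, t, -a, h, by simp⟩
  add_mem' := by
    rintro _ _ ⟨s, t, a, h, rfl⟩ ⟨s', t', b, h', rfl⟩
    obtain ⟨c, d, hcd⟩ := ore s s'
    have h2 : c * t = d * t' := by
      apply toEnv_injective
      rw [inv_mul_eq_iff_eq_mul] at h h'
      rw [map_mul, map_mul, h, h', ← mul_assoc, ← mul_assoc, ← map_mul, ← map_mul, hcd]
    refine ⟨c * s, c * t, α c a + α d b, ?_, ?_⟩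
    · rw [map_mul, map_mul, ← h]; group
    · rw [expand α c s t a, expand α d s' t' b, ← hcd, ← h2, map_add, mul_add, add_mul]

open Classical in
/-- A family of additive subgroups makes the unital ring `R` into a `G`-graded ring. -/
def IsGrading {G : Type v} [Group G] {R : Type w} [Ring R] (𝒜 : G → AddSubgroup R) : Prop :=
  1 ∈ 𝒜 1 ∧ (∀ (g h : G) (x y : R), x ∈ 𝒜 g → y ∈ 𝒜 h → x * y ∈ 𝒜 (g * h)) ∧
    DirectSum.IsInternal 𝒜

end Grading

/-! ### The ideal `I`, the quotient `A/I` and the induced action -/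

section KerIdeal

variable {A : Type u} [Ring A] {S : Type v} [Monoid S]
  [OreSet (⊤ : Submonoid S)] (α : S →* (A →ₙ+* A))

/-- The ideal `I = ⋃_s ker α_s`. -/
def kerIdeal : Ideal A where
  carrier := ⋃ s : S, {a | α s a = 0}
  zero_mem' := by simp
  add_mem' := by
    intro a b ha hb
    simp only [Set.mem_iUnion, Set.mem_ofPred_eq] at *
    obtain ⟨s, hs⟩ := ha
    obtain ⟨t, ht⟩ := hb
    obtain ⟨c, d, h⟩ := ore s t
    refine ⟨c * s, ?_⟩
    rw [map_add, act_mul, hs, h, act_mul, ht]; simp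
  smul_mem' := by
    intro c a ha
    simp only [Set.mem_iUnion, Set.mem_ofPred_eq] at *
    obtain ⟨s, hs⟩ := ha
    exact ⟨s, by rw [smul_eq_mul, map_mul, hs, mul_zero]⟩

theorem mem_kerIdeal {a : A} : a ∈ kerIdeal α ↔ ∃ s, α s a = 0 := by
  change a ∈ (⋃ s : S, {a | α s a = 0}) ↔ _
  simp

instance : (kerIdeal α).IsTwoSided where
  mul_mem_of_left := by
    intro a b ha
    rw [mem_kerIdeal] at *
    obtain ⟨s, hs⟩ := ha
    exact ⟨s, by rw [map_mul, hs, zero_mul]⟩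

theorem act_mem_kerIdeal (s : S) {a : A} (ha : a ∈ kerIdeal α) : α s a ∈ kerIdeal α := by
  rw [mem_kerIdeal] at *
  obtain ⟨t, ht⟩ := ha
  obtain ⟨c, d, h⟩ := ore s t
  exact ⟨c, by rw [← act_mul, h, act_mul, ht, map_zero]⟩

/-- The map `A/I → A/I`, `a + I ↦ α_s(a) + I`. -/
def quotFun (s : S) : (A ⧸ kerIdeal α) → (A ⧸ kerIdeal α) :=
  Quotient.lift (fun a => Ideal.Quotient.mk (kerIdeal α) (α s a)) (by
    intro a b hab
    have h : a - b ∈ kerIdeal α := (Submodule.quotientRel_def _).mp hab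
    rw [Ideal.Quotient.mk_eq_mk_iff_sub_mem, ← map_sub]
    exact act_mem_kerIdeal α s h)

theorem quotFun_mk (s : S) (a : A) : quotFun α s (Ideal.Quotient.mk (kerIdeal α) a) =
    Ideal.Quotient.mk (kerIdeal α) (α s a) := rfl

/-- The endomorphism of `A/I` induced by `α_s`. -/
def quotEnd (s : S) : (A ⧸ kerIdeal α) →ₙ+* (A ⧸ kerIdeal α) where
  toFun := quotFun α s
  map_zero' := by
    rw [← map_zero (Ideal.Quotient.mk (kerIdeal α)), quotFun_mk, map_zero]
  map_mul' x y := by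
    obtain ⟨a, rfl⟩ := Ideal.Quotient.mk_surjective x
    obtain ⟨b, rfl⟩ := Ideal.Quotient.mk_surjective y
    rw [← map_mul, quotFun_mk, quotFun_mk, quotFun_mk, map_mul, map_mul]
  map_add' x y := by
    obtain ⟨a, rfl⟩ := Ideal.Quotient.mk_surjective x
    obtain ⟨b, rfl⟩ := Ideal.Quotient.mk_surjective y
    rw [← map_add, quotFun_mk, quotFun_mk, quotFun_mk, map_add, map_add]

theorem quotEnd_mk (s : S) (a : A) : quotEnd α s (Ideal.Quotient.mk (kerIdeal α) a) =
    Ideal.Quotient.mk (kerIdeal α) (α s a) := rfl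

/-- The action `α'` of `S` on `A/I` induced by `α`. -/
def quotAct : S →* ((A ⧸ kerIdeal α) →ₙ+* (A ⧸ kerIdeal α)) where
  toFun := quotEnd α
  map_one' := by
    ext x
    obtain ⟨a, rfl⟩ := Ideal.Quotient.mk_surjective x
    rw [quotEnd_mk, act_one]; rfl
  map_mul' s t := by
    ext x
    obtain ⟨a, rfl⟩ := Ideal.Quotient.mk_surjective x
    rw [quotEnd_mk, act_mul]; rfl

end KerIdeal

/-! ### The subring `S₋AS₊` and the action on it -/

section SAS

variable {A : Type u} [Ring A] {S : Type v} [Monoid S]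
  [OreSet (⊤ : Submonoid S)] (α : S →* (A →ₙ+* A))

/-- The subring `S₋AS₊ = {s₋ φ(a) s₊}` of the fractional skew monoid ring. -/
def SAS : Subring (FSMR α) where
  carrier := {x | ∃ (s : S) (a : A), x = sm α s * phi α a * sp α s}
  one_mem' := ⟨1, 1, by simp [sm_one, sp_one]⟩
  zero_mem' := ⟨1, 0, by simp⟩
  neg_mem' := by
    rintro _ ⟨s, a, rfl⟩
    exact ⟨s, -a, by simp⟩
  add_mem' := by
    rintro _ _ ⟨s, a, rfl⟩ ⟨t, b, rfl⟩
    obtain ⟨c, d, h⟩ := ore s t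
    refine ⟨c * s, α c a + α d b, ?_⟩
    rw [expand α c s s a, expand α d t t b, ← h, map_add, mul_add, add_mul]
  mul_mem' := by
    rintro _ _ ⟨s, a, rfl⟩ ⟨t, b, rfl⟩
    obtain ⟨c, d, h⟩ := ore s t
    refine ⟨c * s, α c a * α (c * s) 1 * α d b, ?_⟩
    rw [expand α c s s a, expand α d t t b, ← h, map_mul, map_mul, ← sp_sm]
    simp only [mul_assoc]

theorem conj_mem (s : S) {x : FSMR α} (hx : x ∈ SAS α) : sp α s * x * sm α s ∈ SAS α := by
  obtain ⟨t, a, rfl⟩ := hx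
  obtain ⟨c, d, h⟩ := ore t s
  have h1 : sp α s * sm α t = phi α (α s 1) * sm α d * sp α c := by
    rw [← sp_sm]
    calc sp α s * sm α t = sp α s * (sm α t * sm α c) * sp α c := by
          simp only [mul_assoc, sm_sp, mul_one]
      _ = _ := by rw [← sm_mul, h, sm_mul]; simp only [mul_assoc]
  have h2 : sp α t * sm α s = sm α c * sp α d * phi α (α s 1) := by
    rw [← sp_sm]
    calc sp α t * sm α s = sm α c * (sp α c * sp α t) * sm α s := by
          rw [← mul_assoc, sm_sp, one_mul]
      _ = _ := by rw [← sp_mul, h, sp_mul]; simp only [mul_assoc]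
  refine ⟨d, α d (α s 1) * α c a * α d (α s 1), ?_⟩
  calc sp α s * (sm α t * phi α a * sp α t) * sm α s
      = (sp α s * sm α t) * phi α a * (sp α t * sm α s) := by simp only [mul_assoc]
    _ = (phi α (α s 1) * sm α d) * (sp α c * phi α a * sm α c) * (sp α d * phi α (α s 1)) := by
        rw [h1, h2]; simp only [mul_assoc]
    _ = _ := by rw [phi_sm, sp_phi_sm, sp_phi, map_mul, map_mul]; simp only [mul_assoc]

/-- The action `ᾱ` of `S` on `S₋AS₊`, given by `ᾱ_s(x) = s₊ x s₋`. -/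
def sasAct : S →* (SAS α →ₙ+* SAS α) where
  toFun s :=
    { toFun := fun x => ⟨sp α s * x * sm α s, conj_mem α s x.2⟩
      map_zero' := by ext; simp
      map_add' := fun x y => by ext; simp [mul_add, add_mul]
      map_mul' := fun x y => by
        ext
        change sp α s * (x * y) * sm α s = sp α s * x * sm α s * (sp α s * y * sm α s)
        calc sp α s * (x * y : FSMR α) * sm α s
            = sp α s * x * (sm α s * sp α s) * y * sm α s := by
              rw [sm_sp, mul_one]; simp only [mul_assoc]
          _ = _ := by simp only [mul_assoc] }
  map_one' := by
    ext x
    change sp α 1 * x * sm α 1 = x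
    rw [sp_one, sm_one, one_mul, mul_one]
  map_mul' s t := by
    ext x
    change sp α (s * t) * x * sm α (s * t) = sp α s * (sp α t * x * sm α t) * sm α s
    rw [sp_mul, sm_mul]; simp only [mul_assoc]

/-- The natural unital homomorphism `A → S₋AS₊`, `a ↦ φ(a) = 1₋ φ(a) 1₊`. -/
def toSAS : A →+* SAS α :=
  (phi α).codRestrict (SAS α) fun a => ⟨1, a, by simp [sm_one, sp_one]⟩

end SAS

/-! ### The ring `S⁻¹B` -/

section Dilation

variable {B : Type u} [NonUnitalRing B] {S : Type v} [Monoid S] [IsCancelMul S]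
  [OreSet (⊤ : Submonoid S)] (β : S →* (B →ₙ+* B))

/-- `(s₁, a₁) ∼ (s₂, a₂)` iff there are `t₁, t₂` with `t₁ s₁ = t₂ s₂` and
`β_{t₁}(a₁) = β_{t₂}(a₂)`. -/
def dilSetoid : Setoid (S × B) where
  r x y := ∃ t₁ t₂ : S, t₁ * x.1 = t₂ * y.1 ∧ β t₁ x.2 = β t₂ y.2
  iseqv :=
    { refl := fun x => ⟨1, 1, rfl, rfl⟩
      symm := fun ⟨c, d, h, h'⟩ => ⟨d, c, h.symm, h'.symm⟩
      trans := by
        rintro x y z ⟨a, b, h1, h2⟩ ⟨c, d, h3, h4⟩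
        obtain ⟨p, q, hpq⟩ := ore b c
        refine ⟨p * a, q * d, ?_, ?_⟩
        · rw [mul_assoc, h1, ← mul_assoc, hpq, mul_assoc, h3, mul_assoc]
        · rw [act_mul, h2, ← act_mul, hpq, act_mul, h4, act_mul] }

/-- The ring `S⁻¹B` of classes `[s, b]`. -/
def Dil : Type (max u v) := Quotient (dilSetoid β)

namespace Dil

variable {β}

/-- The class `[s, b]`. -/
def mk (β : S →* (B →ₙ+* B)) (s : S) (b : B) : Dil β := Quotient.mk (dilSetoid β) (s, b)

theorem mk_eq {s t : S} {a b : B} :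
    mk β s a = mk β t b ↔ ∃ c d : S, c * s = d * t ∧ β c a = β d b :=
  ⟨fun h => Quotient.exact h, fun h => Quotient.sound h⟩

theorem mk_expand (c s : S) (b : B) : mk β s b = mk β (c * s) (β c b) :=
  mk_eq.mpr ⟨c, 1, by rw [one_mul], by rw [act_one]⟩

theorem ind {P : Dil β → Prop} (h : ∀ s b, P (mk β s b)) (x : Dil β) : P x :=
  Quotient.ind (fun p => h p.1 p.2) x

/-- Common denominators. -/
theorem exists_mk₂ (x y : Dil β) : ∃ s a b, x = mk β s a ∧ y = mk β s b := by
  induction x using ind with | _ s a =>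
  induction y using ind with | _ t b =>
  obtain ⟨c, d, h⟩ := ore s t
  exact ⟨c * s, β c a, β d b, mk_expand _ _ _, by rw [h, ← mk_expand]⟩

theorem exists_mk₃ (x y z : Dil β) :
    ∃ s a b c, x = mk β s a ∧ y = mk β s b ∧ z = mk β s c := by
  obtain ⟨s, a, b, rfl, rfl⟩ := exists_mk₂ x y
  induction z using ind with | _ t e =>
  obtain ⟨c, d, h⟩ := ore s t
  exact ⟨c * s, β c a, β c b, β d e, mk_expand _ _ _, mk_expand _ _ _, by rw [h, ← mk_expand]⟩

theorem map₂_aux (f : B → B → B) (hf : ∀ s a b, β s (f a b) = f (β s a) (β s b))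
    {s s' : S} {a b a' b' : B} (ha : mk β s a = mk β s' a') (hb : mk β s b = mk β s' b') :
    mk β s (f a b) = mk β s' (f a' b') := by
  obtain ⟨t₁, t₂, h1, h2⟩ := mk_eq.mp ha
  obtain ⟨u₁, u₂, h3, h4⟩ := mk_eq.mp hb
  obtain ⟨p, q, h⟩ := ore t₁ u₁
  have h' : p * t₂ = q * u₂ := by
    apply mul_right_cancel (b := s')
    rw [mul_assoc, ← h1, ← mul_assoc, h, mul_assoc, h3, mul_assoc]
  refine mk_eq.mpr ⟨p * t₁, p * t₂, by rw [mul_assoc, h1, mul_assoc], ?_⟩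
  rw [hf, hf]
  congr 1
  · rw [act_mul, h2, act_mul]
  · rw [h, act_mul, h4, h', act_mul]

/-- A binary operation on `B` that commutes with the action, extended to `S⁻¹B` by
`[s₁, a₁], [s₂, a₂] ↦ [t₁ s₁, f (β_{t₁} a₁) (β_{t₂} a₂)]` for any `t₁ s₁ = t₂ s₂`. -/
def map₂ (f : B → B → B) (hf : ∀ s a b, β s (f a b) = f (β s a) (β s b)) (x y : Dil β) : Dil β :=
  Quotient.liftOn₂ x y
    (fun p q => mk β ((ore p.1 q.1).choose * p.1)
      (f (β (ore p.1 q.1).choose p.2) (β (ore p.1 q.1).choose_spec.choose q.2)))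
    (by
      intro p q p' q' hp hq
      have e : (ore p.1 q.1).choose * p.1 = (ore p.1 q.1).choose_spec.choose * q.1 :=
        (ore p.1 q.1).choose_spec.choose_spec
      have e' : (ore p'.1 q'.1).choose * p'.1 = (ore p'.1 q'.1).choose_spec.choose * q'.1 :=
        (ore p'.1 q'.1).choose_spec.choose_spec
      apply map₂_aux f hf
      · rw [← mk_expand, ← mk_expand]; exact Quotient.sound hp
      · refine (congrArg (fun z => mk β z _) e).trans (Eq.trans ?_
          (congrArg (fun z => mk β z _) e').symm)
        exact (mk_expand _ _ _).symm.trans ((Quotient.sound hq).trans (mk_expand _ _ _)))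

theorem map₂_mk (f : B → B → B) (hf : ∀ s a b, β s (f a b) = f (β s a) (β s b)) (s : S) (a b : B) :
    map₂ f hf (mk β s a) (mk β s b) = mk β s (f a b) := by
  have e : (ore s s).choose * s = (ore s s).choose_spec.choose * s :=
    (ore s s).choose_spec.choose_spec
  have e' : (ore s s).choose = (ore s s).choose_spec.choose := mul_right_cancel e
  change mk β ((ore s s).choose * s)
    (f (β (ore s s).choose a) (β (ore s s).choose_spec.choose b)) = _
  rw [← e', ← hf, ← mk_expand]

instance : Add (Dil β) := ⟨map₂ (· + ·) fun s a b => map_add (β s) a b⟩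
instance : Mul (Dil β) := ⟨map₂ (· * ·) fun s a b => map_mul (β s) a b⟩
instance : Zero (Dil β) := ⟨mk β 1 0⟩
instance : Neg (Dil β) := ⟨fun x => Quotient.liftOn x (fun p => mk β p.1 (-p.2)) (by
  rintro p q ⟨c, d, h, h'⟩
  exact mk_eq.mpr ⟨c, d, h, by rw [map_neg, map_neg, h']⟩)⟩

theorem mk_add (s : S) (a b : B) : mk β s a + mk β s b = mk β s (a + b) := map₂_mk _ _ s a b
theorem mk_mul (s : S) (a b : B) : mk β s a * mk β s b = mk β s (a * b) := map₂_mk _ _ s a b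
theorem mk_neg (s : S) (a : B) : -mk β s a = mk β s (-a) := rfl
theorem mk_zero (s : S) : mk β s 0 = 0 :=
  mk_eq.mpr ⟨1, s, by simp, by simp⟩

instance : NonUnitalRing (Dil β) where
  add_assoc x y z := by
    obtain ⟨s, a, b, c, rfl, rfl, rfl⟩ := exists_mk₃ x y z
    simp only [mk_add, add_assoc]
  zero_add x := by
    induction x using ind with | _ s a => rw [← mk_zero s, mk_add, zero_add]
  add_zero x := by
    induction x using ind with | _ s a => rw [← mk_zero s, mk_add, add_zero]
  nsmul := nsmulRec
  zsmul := zsmulRec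
  neg_add_cancel x := by
    induction x using ind with | _ s a => rw [mk_neg, mk_add, neg_add_cancel, mk_zero]
  add_comm x y := by
    obtain ⟨s, a, b, rfl, rfl⟩ := exists_mk₂ x y
    simp only [mk_add, add_comm]
  left_distrib x y z := by
    obtain ⟨s, a, b, c, rfl, rfl, rfl⟩ := exists_mk₃ x y z
    simp only [mk_add, mk_mul, mul_add]
  right_distrib x y z := by
    obtain ⟨s, a, b, c, rfl, rfl, rfl⟩ := exists_mk₃ x y z
    simp only [mk_add, mk_mul, add_mul]
  zero_mul x := by
    induction x using ind with | _ s a => rw [← mk_zero s, mk_mul, zero_mul]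
  mul_zero x := by
    induction x using ind with | _ s a => rw [← mk_zero s, mk_mul, mul_zero]
  mul_assoc x y z := by
    obtain ⟨s, a, b, c, rfl, rfl, rfl⟩ := exists_mk₃ x y z
    simp only [mk_mul, mul_assoc]

/-- The natural homomorphism `B → S⁻¹B`, `b ↦ [1, b]`. -/
def of (β : S →* (B →ₙ+* B)) : B →ₙ+* Dil β where
  toFun := mk β 1
  map_zero' := mk_zero 1
  map_add' a b := (mk_add 1 a b).symm
  map_mul' a b := (mk_mul 1 a b).symm

end Dil

end Dilation

/-! ### Skew group rings -/

section SkewGroupRing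

variable {C : Type u} [NonUnitalRing C] {G : Type v} [Group G] (γ : G →* RingAut C)

/-- The skew group ring `C *_γ G` over a not necessarily unital ring `C`: finite formal sums
`∑ c_g g`, multiplied by `(c g)(d h) = c γ_g(d) gh`. -/
def SkewGroupRing (_γ : G →* RingAut C) : Type (max u v) := G →₀ C

namespace SkewGroupRing

instance : AddCommGroup (SkewGroupRing γ) := inferInstanceAs (AddCommGroup (G →₀ C))

/-- The monomial `c g`. -/
def single (g : G) (c : C) : SkewGroupRing γ := Finsupp.single g c

/-- The coefficient of `g`. -/
def coeff (x : SkewGroupRing γ) (g : G) : C := (show G →₀ C from x) g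

instance : Mul (SkewGroupRing γ) :=
  ⟨fun x y => Finsupp.sum (show G →₀ C from x) fun g c =>
    Finsupp.sum (show G →₀ C from y) fun h d => single γ (g * h) (c * γ g d)⟩

theorem single_add (g : G) (c d : C) : single γ g (c + d) = single γ g c + single γ g d :=
  Finsupp.single_add g c d

theorem single_zero (g : G) : single γ g 0 = 0 := Finsupp.single_zero g

theorem single_mul_single (g h : G) (c d : C) :
    single γ g c * single γ h d = single γ (g * h) (c * γ g d) := by
  change Finsupp.sum (Finsupp.single g c) (fun g c =>
    Finsupp.sum (Finsupp.single h d) fun h d => single γ (g * h) (c * γ g d)) = _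
  rw [Finsupp.sum_single_index, Finsupp.sum_single_index]
  · rw [map_zero, mul_zero, single_zero]
  · simp [single_zero]

theorem mul_add' (x y z : SkewGroupRing γ) : x * (y + z) = x * y + x * z := by
  change Finsupp.sum (show G →₀ C from x) _ = Finsupp.sum (show G →₀ C from x) _ +
    Finsupp.sum (show G →₀ C from x) _
  rw [← Finsupp.sum_add]
  refine Finsupp.sum_congr fun g _ => ?_
  refine Finsupp.sum_add_index' (fun h => ?_) (fun h d d' => ?_)
  · rw [map_zero, mul_zero, single_zero]
  · rw [map_add, mul_add, single_add]

theorem add_mul' (x y z : SkewGroupRing γ) : (x + y) * z = x * z + y * z := by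
  refine Finsupp.sum_add_index' (fun h => ?_) (fun h d d' => ?_)
  · simp only [zero_mul, single_zero]
    exact Finset.sum_const_zero
  · rw [← Finsupp.sum_add]
    refine Finsupp.sum_congr fun g _ => ?_
    rw [add_mul, single_add]

theorem zero_mul' (x : SkewGroupRing γ) : 0 * x = 0 := Finsupp.sum_zero_index

theorem mul_zero' (x : SkewGroupRing γ) : x * 0 = 0 := by
  simpa using mul_add' γ x 0 0

theorem induction {P : SkewGroupRing γ → Prop} (x : SkewGroupRing γ) (h0 : P 0)
    (hadd : ∀ x y, P x → P y → P (x + y)) (hs : ∀ g c, P (single γ g c)) : P x :=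
  Finsupp.induction_linear (motive := P) x h0 hadd hs

theorem mul_assoc' (x y z : SkewGroupRing γ) : x * y * z = x * (y * z) := by
  induction x using induction with
  | h0 => simp only [zero_mul']
  | hadd x x' hx hx' => simp only [add_mul', hx, hx']
  | hs g c =>
    induction y using induction with
    | h0 => simp only [zero_mul', mul_zero']
    | hadd x x' hx hx' => simp only [add_mul', mul_add', hx, hx']
    | hs h d =>
      induction z using induction with
      | h0 => simp only [mul_zero']
      | hadd x x' hx hx' => simp only [mul_add', hx, hx']
      | hs k e =>
        simp only [single_mul_single, mul_assoc, map_mul, RingAut.mul_apply]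

instance : NonUnitalRing (SkewGroupRing γ) where
  left_distrib := mul_add' γ
  right_distrib := add_mul' γ
  zero_mul := zero_mul' γ
  mul_zero := mul_zero' γ
  mul_assoc := mul_assoc' γ

/-- An idempotent `e` of `C`, viewed as `e · 1_G`, is an idempotent of `C *_γ G`. -/
theorem isIdempotentElem_single {e : C} (he : IsIdempotentElem e) :
    IsIdempotentElem (single γ 1 e) := by
  change single γ 1 e * single γ 1 e = single γ 1 e
  rw [single_mul_single, mul_one, map_one, RingAut.one_apply, he.eq]

variable {γ}

/-- The component of degree `g` of the corner `e(C *_γ G)e`: its intersection with `C g`. -/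
def cornerComponent {e : SkewGroupRing γ} (he : IsIdempotentElem e) (g : G) :
    AddSubgroup he.Corner where
  carrier := {x | ∃ c : C, x.1 = single γ g c}
  zero_mem' := ⟨0, (single_zero γ g).symm⟩
  add_mem' := by
    rintro x y ⟨c, hc⟩ ⟨d, hd⟩
    refine ⟨c + d, ?_⟩
    rw [single_add, ← hc, ← hd]; rfl
  neg_mem' := by
    rintro x ⟨c, hc⟩
    refine ⟨-c, ?_⟩
    change -x.1 = _
    rw [hc]
    exact (Finsupp.single_neg g c).symm

end SkewGroupRing

end SkewGroupRing

/-! ### The dilated ring `S⁻¹(S₋(A/I)S₊)` -/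

section Dilated

variable {A : Type u} [Ring A] {S : Type v} [Monoid S] [IsCancelMul S]
  [OreSet (⊤ : Submonoid S)] (α : S →* (A →ₙ+* A))

/-- The ring `S⁻¹(S₋(A/I)S₊)`. -/
abbrev DilatedRing : Type (max u v) := Dil (sasAct (quotAct α))

/-- The natural homomorphism `A → A/I → S₋(A/I)S₊ → S⁻¹(S₋(A/I)S₊)`. -/
def toDilated : A →ₙ+* DilatedRing α :=
  (Dil.of (sasAct (quotAct α))).comp
    (((toSAS (quotAct α)).comp (Ideal.Quotient.mk (kerIdeal α)) :
      A →+* SAS (quotAct α)) : A →ₙ+* SAS (quotAct α))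

end Dilated

end

end FracSkew

namespace FracSkew

noncomputable section

open OreLocalization

universe u v w

/-! The argument works with any ring `D` carrying a `G`-action `γ` and a covariant map `j : A → D`,
that is `γ_s ∘ j = j ∘ α_s`. Put `e = j(1)`; then `γ_s(e) = j(α_s(1)) ≤ e`. The elements `j(a)·1`,
`e s⁻¹` and `γ_s(e) s` of the corner `e(D * G)e` satisfy the defining relations, so they give a
homomorphism `toCorner`. It sends `s₋ φ(a) t₊` to a monomial of degree `s⁻¹t` with coefficient
`γ_s⁻¹(j(α_s(1) a α_t(1)))`. On each component it is injective if `ker j ⊆ I`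
(`eq_zero_of_toCorner_eq_zero`) and onto if every element of `D` is some `γ_s⁻¹(j(a))`
(`map_component_toCorner`). The corner is visibly graded, while the components of the skew monoid
ring are only seen to span. Comparing the two yields both the bijection and the independence of the
components, with no normal form for fractions. It remains to check `D = S⁻¹B`. That `ker j = I`
needs control of `ker φ`, for which the same homomorphism is used a first time with `D = S⁻¹A`,
where the kernel is visible from the construction. -/

section GradedBijective

/-! ### Transfer of direct sum decompositions. -/

/-- An additive map that carries a spanning family of subgroups injectively, degree by degree, onto
an internal direct sum decomposition is bijective, and the spanning family is internal too. -/
theorem isInternal_and_bijective_of_map_eq {ι M N : Type*} [DecidableEq ι] [AddCommGroup M]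
    [AddCommGroup N] {𝒜 : ι → AddSubgroup M} {ℬ : ι → AddSubgroup N} (F : M →+ N)
    (hsup : ⨆ i, 𝒜 i = ⊤) (hℬ : DirectSum.IsInternal ℬ) (hmap : ∀ i, (𝒜 i).map F = ℬ i)
    (hinj : ∀ i, ∀ x ∈ 𝒜 i, F x = 0 → x = 0) :
    DirectSum.IsInternal 𝒜 ∧ Function.Bijective F := by
  let f (i : ι) : 𝒜 i →+ ℬ i :=
    (F.comp (𝒜 i).subtype).codRestrict (ℬ i) fun x => hmap i ▸ ⟨x, x.2, rfl⟩
  have hf (i : ι) : Function.Bijective (f i) := by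
    refine ⟨(injective_iff_map_eq_zero _).mpr fun x hx => ?_, fun y => ?_⟩
    · exact Subtype.ext (hinj i x x.2 (congrArg Subtype.val hx))
    · obtain ⟨y, hy⟩ := y
      rw [← hmap i] at hy
      obtain ⟨x, hx, rfl⟩ := hy
      exact ⟨⟨x, hx⟩, rfl⟩
  have hcomp : ∀ x, F (DirectSum.coeAddMonoidHom 𝒜 x) =
      DirectSum.coeAddMonoidHom ℬ (DirectSum.map f x) := by
    intro x
    induction x using DirectSum.induction_on with
    | zero => simp
    | of i x => simp [f]
    | add x y hx hy => simp only [map_add, hx, hy]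
  have hbij : Function.Bijective (F ∘ DirectSum.coeAddMonoidHom 𝒜) := by
    rw [show F ∘ DirectSum.coeAddMonoidHom 𝒜 = DirectSum.coeAddMonoidHom ℬ ∘ DirectSum.map f from
      funext hcomp]
    exact hℬ.comp ⟨DirectSum.map_injective f |>.mpr fun i => (hf i).1,
      DirectSum.map_surjective f |>.mpr fun i => (hf i).2⟩
  have hint : DirectSum.IsInternal 𝒜 := by
    -- Injectivity of the composite with `F` gives independence of the `𝒜 i`; surjectivity of the
    -- sum map is `hsup`.
    refine ⟨hbij.1.of_comp, fun x => ?_⟩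
    have hx : x ∈ ⨆ i, 𝒜 i := hsup ▸ AddSubgroup.mem_top x
    refine AddSubgroup.iSup_induction 𝒜 (C := fun x => ∃ y, DirectSum.coeAddMonoidHom 𝒜 y = x) hx
      (fun i x hx => ⟨DirectSum.of _ i ⟨x, hx⟩, DirectSum.coeAddMonoidHom_of ..⟩)
      ⟨0, map_zero _⟩ ?_
    rintro _ _ ⟨x, rfl⟩ ⟨y, rfl⟩
    exact ⟨x + y, map_add ..⟩
  exact ⟨hint, (Function.Bijective.of_comp_iff _ hint).mp hbij⟩

end GradedBijective

/-! ### The grading of a corner of a skew group ring. -/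

namespace SkewGroupRing

variable {C : Type u} [NonUnitalRing C] {G : Type v} [Group G] (γ : G →* RingAut C)

/-- The coefficient at `g`, as an additive map. -/
def coeffHom (g : G) : SkewGroupRing γ →+ C := Finsupp.applyAddHom (M := C) g

theorem coeffHom_single_same (g : G) (c : C) : coeffHom γ g (single γ g c) = c :=
  Finsupp.single_eq_same

theorem coeffHom_single_of_ne {g h : G} (hgh : g ≠ h) (c : C) :
    coeffHom γ h (single γ g c) = 0 :=
  Finsupp.single_eq_of_ne' hgh

theorem single_injective (g : G) : Function.Injective (single γ g) :=
  Finsupp.single_injective g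

theorem single_one_mul_single (e c : C) (g : G) :
    single γ 1 e * single γ g c = single γ g (e * c) := by
  rw [single_mul_single, one_mul, map_one, RingAut.one_apply]

theorem single_mul_single_one (e c : C) (g : G) :
    single γ g c * single γ 1 e = single γ g (c * γ g e) := by
  rw [single_mul_single, mul_one]

variable {γ}

/-- Moving `e` leftwards past `g` twists it, so the right-hand condition involves `γ g e`. -/
theorem single_mem_corner_iff {e : C} (he : IsIdempotentElem e) {g : G} {c : C} :
    single γ g c ∈ Subsemigroup.corner (single γ 1 e) ↔ e * c = c ∧ c * γ g e = c := by
  rw [Subsemigroup.mem_corner_iff (isIdempotentElem_single γ he), single_one_mul_single,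
    single_mul_single_one, (single_injective γ g).eq_iff, (single_injective γ g).eq_iff]

section Corner

variable {e : SkewGroupRing γ} (he : IsIdempotentElem e)

/-- The inclusion of a corner, as an additive map. -/
def cornerVal : he.Corner →+ SkewGroupRing γ where
  toFun x := x.1
  map_zero' := rfl
  map_add' _ _ := rfl

/-- The compression `x ↦ e x e` onto a corner, as an additive map. -/
def compress : SkewGroupRing γ →+ he.Corner where
  toFun x := ⟨e * x * e, x, rfl⟩
  map_zero' := Subtype.ext (by change e * 0 * e = 0; simp)
  map_add' x y := Subtype.ext (by
    change e * (x + y) * e = e * x * e + e * y * e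
    rw [mul_add, add_mul])

theorem compress_surjective : Function.Surjective (compress he) := by
  rintro ⟨_, y, rfl⟩
  exact ⟨y, rfl⟩

end Corner

variable {e : C} (he : IsIdempotentElem e)

-- Independence is read off coefficient by coefficient. The components span because `e(c g)e = (e c
-- γ_g(e)) g`: compression, which is onto the corner, takes monomials to monomials.
open Classical in
theorem isInternal_cornerComponent :
    DirectSum.IsInternal (cornerComponent (isIdempotentElem_single γ he)) := by
  set he' := isIdempotentElem_single γ he
  refine ⟨(injective_iff_map_eq_zero _).mpr fun x hx => ?_, fun x => ?_⟩
  · have key : ∀ x g, coeffHom γ g (cornerVal he'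
        (DirectSum.coeAddMonoidHom (cornerComponent he') x)) =
        coeffHom γ g (cornerVal he' (x g)) := by
      intro x g
      induction x using DirectSum.induction_on with
      | zero => simp
      | of i x =>
        rw [DirectSum.coeAddMonoidHom_of, DirectSum.coe_of_apply]
        split_ifs with h
        · rfl
        · obtain ⟨c, hc⟩ := x.2
          rw [show cornerVal he' x = single γ i c from hc, coeffHom_single_of_ne γ h,
            ZeroMemClass.coe_zero, map_zero, map_zero]
      | add x y hx hy => simp only [map_add, hx, hy, DirectSum.add_apply, AddSubgroup.coe_add]
    ext g : 1
    refine Subtype.ext (Subtype.ext ?_)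
    have hg := key x g
    obtain ⟨c, hc⟩ := (x g).2
    rw [hx, map_zero, map_zero, show cornerVal he' (x g) = single γ g c from hc,
      coeffHom_single_same] at hg
    rw [hc, ← hg]
    exact single_zero γ g
  · obtain ⟨y, rfl⟩ := compress_surjective he' x
    induction y using induction with
    | h0 => exact ⟨0, by rw [map_zero, map_zero]⟩
    | hadd x y hx hy =>
      obtain ⟨x', hx⟩ := hx
      obtain ⟨y', hy⟩ := hy
      exact ⟨x' + y', by rw [map_add, map_add, hx, hy]⟩
    | hs g c =>
      refine ⟨DirectSum.of _ g ⟨compress he' (single γ g c), e * c * γ g e, ?_⟩,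
        DirectSum.coeAddMonoidHom_of ..⟩
      change single γ 1 e * single γ g c * single γ 1 e = _
      rw [single_one_mul_single, single_mul_single_one]

theorem mul_mem_cornerComponent {e : SkewGroupRing γ} (he : IsIdempotentElem e) {g h : G}
    {x y : he.Corner} (hx : x ∈ cornerComponent he g) (hy : y ∈ cornerComponent he h) :
    x * y ∈ cornerComponent he (g * h) := by
  obtain ⟨c, hc⟩ := hx
  obtain ⟨d, hd⟩ := hy
  refine ⟨c * γ g d, ?_⟩
  rw [← single_mul_single, ← hc, ← hd]
  rfl

theorem isGrading_cornerComponent :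
    IsGrading (cornerComponent (isIdempotentElem_single γ he)) :=
  ⟨⟨e, rfl⟩, fun _ _ _ _ => mul_mem_cornerComponent _, isInternal_cornerComponent he⟩

end SkewGroupRing

/-! ### Fractions in the skew monoid ring. -/

section Components

variable {A : Type u} [Ring A] {S : Type v} [Monoid S] [IsCancelMul S]
  [OreSet (⊤ : Submonoid S)] (α : S →* (A →ₙ+* A))

/-- The rule for turning `t₊ u₋` into a fraction: insert `d₋ d₊ = 1`, then use `u₋ d₋ = (du)₋ =
(ct)₋ = t₋ c₋`. -/
theorem sp_mul_sm {c d t u : S} (h : c * t = d * u) :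
    sp α t * sm α u = sm α c * phi α (α c (α t 1)) * sp α d := by
  calc sp α t * sm α u = sp α t * (sm α u * sm α d) * sp α d := by
        simp only [mul_assoc, sm_sp, mul_one]
    _ = sp α t * sm α t * sm α c * sp α d := by
        rw [← sm_mul, ← h, sm_mul]; simp only [mul_assoc]
    _ = _ := by rw [sp_sm, phi_sm]

/-- Since `s₋` absorbs `φ(α_s(1))` on its right and `t₊` absorbs `φ(α_t(1))` on its left, only the
truncated coefficient matters; `toCorner` sees exactly that one. -/
theorem frac_eq_phi (s t : S) (a : A) : sm α s * phi α a * sp α t =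
    sm α s * phi α (α s 1 * a * α t 1) * sp α t := by
  rw [map_mul, map_mul]
  simp only [mul_assoc, phi_p_sp]
  rw [← mul_assoc (sm α s) (phi α (α s 1)), sm_phi_p]

theorem mul_mem_component {g h : EnvelopingGroup S} {x y : FSMR α} (hx : x ∈ component α g)
    (hy : y ∈ component α h) : x * y ∈ component α (g * h) := by
  obtain ⟨s, t, a, rfl, rfl⟩ := hx
  obtain ⟨s', t', b, rfl, rfl⟩ := hy
  obtain ⟨c, d, hcd⟩ := ore t s'
  refine ⟨c * s, d * t', α c a * α c (α t 1) * α d b, ?_, ?_⟩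
  · have h : toEnv c * toEnv t = toEnv d * toEnv s' := by rw [← map_mul, hcd, map_mul]
    have h2 : toEnv t = (toEnv c)⁻¹ * (toEnv d * toEnv s') := by rw [← h]; group
    rw [map_mul, map_mul, h2]; group
  · calc sm α s * phi α a * sp α t * (sm α s' * phi α b * sp α t')
        = sm α s * phi α a * (sp α t * sm α s') * phi α b * sp α t' := by
          simp only [mul_assoc]
      _ = sm α s * (phi α a * sm α c) * phi α (α c (α t 1)) * (sp α d * phi α b) * sp α t' := by
          rw [sp_mul_sm α hcd]; simp only [mul_assoc]
      _ = _ := by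
          rw [phi_sm, sp_phi, sm_mul, sp_mul, map_mul, map_mul]; simp only [mul_assoc]

/-- The sum of the components contains `1` and all generators and is closed under products, so it is
everything. -/
theorem iSup_component : ⨆ g, component α g = ⊤ := by
  have hmem (s t : S) (a : A) : sm α s * phi α a * sp α t ∈ ⨆ g, component α g :=
    AddSubgroup.mem_iSup_of_mem _ ⟨s, t, a, rfl, rfl⟩
  have hone : (1 : FSMR α) ∈ ⨆ g, component α g := by
    simpa [sm_one, sp_one] using hmem 1 1 1
  have hmul : ∀ x ∈ ⨆ g, component α g, ∀ y ∈ ⨆ g, component α g,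
      x * y ∈ ⨆ g, component α g := by
    intro x hx y hy
    refine AddSubgroup.iSup_induction _ (C := (· * y ∈ _)) hx (fun g x hx => ?_)
      (by rw [zero_mul]; exact zero_mem _) fun x x' h h' => by rw [add_mul]; exact add_mem h h'
    exact AddSubgroup.iSup_induction _ (C := (x * · ∈ _)) hy
      (fun h y hy => AddSubgroup.mem_iSup_of_mem _ (mul_mem_component α hx hy))
      (by rw [mul_zero]; exact zero_mem _) fun y y' h h' => by rw [mul_add]; exact add_mem h h'
  refine (AddSubgroup.eq_top_iff' _).mpr fun x => ?_
  obtain ⟨x, rfl⟩ : ∃ y, quo α y = x := RingQuot.mkRingHom_surjective (Rel α) x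
  induction x using FreeAlgebra.induction with
  | grade0 n =>
    rw [eq_intCast, map_intCast, ← zsmul_one]
    exact zsmul_mem hone n
  | grade1 x =>
    rcases x with a | s | s
    · have h := hmem 1 1 a
      rwa [sm_one, sp_one, one_mul, mul_one] at h
    · have h := hmem s 1 1
      rwa [map_one, sp_one, mul_one, mul_one] at h
    · have h := hmem 1 s 1
      rwa [map_one, sm_one, one_mul, one_mul] at h
  | mul x y hx hy => rw [map_mul]; exact hmul _ hx _ hy
  | add x y hx hy => rw [map_add]; exact add_mem hx hy

end Components

/-! ### The action of the enveloping group on `S⁻¹B`. -/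

section DilAction

variable {S : Type v} [Monoid S] [IsCancelMul S] [OreSet (⊤ : Submonoid S)]

/-- The universal property of the enveloping group: a homomorphism from `S` to a group extends to
`G = S⁻¹S`. -/
def envLift {H : Type w} [Group H] (f : S →* H) : EnvelopingGroup S →* H :=
  let F := universalMulHom f (toUnits.toMonoidHom.comp (f.comp (⊤ : Submonoid S).subtype))
    fun _ => rfl
  { toFun := F
    map_one' := map_one F
    map_mul' := map_mul F }

theorem envLift_toEnv {H : Type w} [Group H] (f : S →* H) (s : S) : envLift f (toEnv s) = f s :=
  universalMulHom_commutes f (toUnits.toMonoidHom.comp (f.comp (⊤ : Submonoid S).subtype))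
    fun _ => rfl

namespace Dil

variable {B : Type u} [NonUnitalRing B] (β : S →* (B →ₙ+* B))

/-- The endomorphism `[t, b] ↦ [t s, b]` of `S⁻¹B`. -/
def shift (s : S) : Dil β →ₙ+* Dil β where
  toFun := Quotient.map (fun p => (p.1 * s, p.2)) fun _ _ ⟨c, d, h, h'⟩ =>
    ⟨c, d, by rw [← mul_assoc, h, mul_assoc], h'⟩
  map_zero' := mk_zero (1 * s)
  map_add' x y := by
    obtain ⟨t, a, b, rfl, rfl⟩ := exists_mk₂ x y
    rw [mk_add]
    exact (mk_add (t * s) a b).symm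
  map_mul' x y := by
    obtain ⟨t, a, b, rfl, rfl⟩ := exists_mk₂ x y
    rw [mk_mul]
    exact (mk_mul (t * s) a b).symm

theorem shift_mk (s t : S) (b : B) : shift β s (mk β t b) = mk β (t * s) b := rfl

/-- Right cancellation in `S` gives injectivity. For surjectivity, if `c t = d s` then `[t, b] = [d
s, β_c(b)]` is the shift of `[d, β_c(b)]`. -/
theorem shift_bijective (s : S) : Function.Bijective (shift β s) := by
  constructor
  · intro x y h
    obtain ⟨t, a, b, rfl, rfl⟩ := exists_mk₂ x y
    rw [shift_mk, shift_mk, mk_eq] at h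
    obtain ⟨c, d, h, h'⟩ := h
    exact mk_eq.mpr ⟨c, d, mul_right_cancel (by simpa only [mul_assoc] using h), h'⟩
  · intro x
    induction x using ind with | _ t b =>
    obtain ⟨c, d, h⟩ := ore t s
    exact ⟨mk β d (β c b), by rw [shift_mk, ← h, ← mk_expand]⟩

/-- The shift by `s` as an automorphism of `S⁻¹B`. -/
def shiftAut (s : S) : RingAut (Dil β) := RingEquiv.ofBijective (shift β s) (shift_bijective β s)

theorem shiftAut_mk (s t : S) (b : B) : shiftAut β s (mk β t b) = mk β (t * s) b := rfl

/-- The action of `S` on `S⁻¹B` by automorphisms: `s` acts as the inverse of `[t, b] ↦ [t s, b]`. -/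
def monoidAct : S →* RingAut (Dil β) where
  toFun s := (shiftAut β s)⁻¹
  map_one' := by
    rw [inv_eq_one]
    ext x
    induction x using ind with | _ t b => rw [shiftAut_mk, mul_one, RingAut.one_apply]
  -- Shifts reverse products, `[u, b] ↦ [u s t, b]` being the shift by `s` followed by that by `t`;
  -- inverting restores the order.
  map_mul' s t := by
    rw [← mul_inv_rev, inv_inj]
    ext x
    induction x using ind with | _ u b =>
    rw [RingAut.mul_apply, shiftAut_mk, shiftAut_mk, shiftAut_mk, mul_assoc]

/-- The action of the enveloping group `G` on `S⁻¹B` by automorphisms. -/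
def act : EnvelopingGroup S →* RingAut (Dil β) := envLift (monoidAct β)

theorem act_inv_toEnv_mk (s t : S) (b : B) : act β (toEnv s)⁻¹ (mk β t b) = mk β (t * s) b := by
  rw [map_inv, act, envLift_toEnv, monoidAct, MonoidHom.coe_mk, OneHom.coe_mk, inv_inv,
    shiftAut_mk]

/-- Covariance of `b ↦ [1, b]`: expansion gives `[1, b] = [s, β_s(b)]`, which is `s⁻¹` applied to
`[1, β_s(b)]`. -/
theorem act_toEnv_of (s : S) (b : B) : act β (toEnv s) (of β b) = of β (β s b) := by
  have h : of β b = act β (toEnv s)⁻¹ (of β (β s b)) := by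
    change mk β 1 b = act β (toEnv s)⁻¹ (mk β 1 (β s b))
    rw [act_inv_toEnv_mk, one_mul, mk_expand s, mul_one]
  rw [h, ← RingAut.mul_apply, ← map_mul, mul_inv_cancel, map_one, RingAut.one_apply]

theorem of_eq_zero_iff {b : B} : of β b = 0 ↔ ∃ s, β s b = 0 := by
  change mk β 1 b = mk β 1 0 ↔ _
  rw [mk_eq]
  refine ⟨fun ⟨c, _, _, h⟩ => ⟨c, by rw [h, map_zero]⟩, fun ⟨s, h⟩ => ⟨s, s, rfl, ?_⟩⟩
  rw [h, map_zero]

end Dil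

end DilAction

/-! ### The homomorphism to the corner defined by a covariant map. -/

section Covariant

open SkewGroupRing

variable {A : Type u} [Ring A] {S : Type v} [Monoid S] [IsCancelMul S]
  [OreSet (⊤ : Submonoid S)] {α : S →* (A →ₙ+* A)} {D : Type w} [NonUnitalRing D]
  {γ : EnvelopingGroup S →* RingAut D} {j : A →ₙ+* D}

theorem isIdempotentElem_map_one (j : A →ₙ+* D) : IsIdempotentElem (j 1) := by
  rw [IsIdempotentElem, ← map_mul, mul_one]

theorem map_one_mul_map (j : A →ₙ+* D) (a : A) : j 1 * j a = j a := by rw [← map_mul, one_mul]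

theorem map_mul_map_one (j : A →ₙ+* D) (a : A) : j a * j 1 = j a := by rw [← map_mul, mul_one]

theorem act_inv_of_covariant (hj : ∀ s a, γ (toEnv s) (j a) = j (α s a)) (s : S) (a : A) :
    γ (toEnv s)⁻¹ (j (α s a)) = j a := by
  rw [← hj, ← RingAut.mul_apply, ← map_mul, inv_mul_cancel, map_one, RingAut.one_apply]

/-- Here `e = γ_s⁻¹(j(α_s(1)))`, so multiplication by `e` takes place inside `γ_s⁻¹ ∘ j`. -/
theorem map_one_mul_act_inv (hj : ∀ s a, γ (toEnv s) (j a) = j (α s a)) (s : S) (a : A) :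
    j 1 * γ (toEnv s)⁻¹ (j a) = γ (toEnv s)⁻¹ (j (α s 1 * a)) := by
  rw [map_mul, map_mul, act_inv_of_covariant hj]

/-- The right-hand counterpart: `γ_{s⁻¹t}(e) = γ_s⁻¹(j(α_t(1)))`. -/
theorem act_inv_mul_act_map_one (hj : ∀ s a, γ (toEnv s) (j a) = j (α s a)) (s t : S) (a : A) :
    γ (toEnv s)⁻¹ (j a) * γ ((toEnv s)⁻¹ * toEnv t) (j 1) =
      γ (toEnv s)⁻¹ (j (a * α t 1)) := by
  rw [map_mul, RingAut.mul_apply, hj, map_mul, map_mul]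

/-- The corner `e(D *_γ G)e`, with `e = j 1`. -/
abbrev CovCorner (γ : EnvelopingGroup S →* RingAut D) (j : A →ₙ+* D) : Type (max v w) :=
  (isIdempotentElem_single γ (isIdempotentElem_map_one j)).Corner

/-- The element `j(a) · 1` of the corner. -/
def cornerCoef (γ : EnvelopingGroup S →* RingAut D) (j : A →ₙ+* D) : A →+* CovCorner γ j where
  toFun a := ⟨single γ 1 (j a), (single_mem_corner_iff (isIdempotentElem_map_one j)).mpr
    ⟨map_one_mul_map j a, by rw [map_one, RingAut.one_apply, map_mul_map_one]⟩⟩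
  map_one' := rfl
  map_zero' := Subtype.ext ((congrArg (single γ 1) (map_zero j)).trans (single_zero γ 1))
  map_add' a b := Subtype.ext ((congrArg (single γ 1) (map_add j a b)).trans (single_add γ 1 _ _))
  map_mul' a b := Subtype.ext <| by
    change single γ 1 (j (a * b)) = single γ 1 (j a) * single γ 1 (j b)
    rw [single_one_mul_single, map_mul]

/-- The elements `e · s⁻¹` of the corner. -/
def cornerMinus (hj : ∀ s a, γ (toEnv s) (j a) = j (α s a)) : Sᵐᵒᵖ →* CovCorner γ j where
  toFun s := ⟨single γ (toEnv s.unop)⁻¹ (j 1),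
    (single_mem_corner_iff (isIdempotentElem_map_one j)).mpr
      ⟨map_one_mul_map j 1, by
        -- The claim is `e γ_s⁻¹(e) = e`; the left factor is written as `γ_s⁻¹(j(α_s(1)))`, and
        -- `j(α_s(1))` absorbs `j(1)`.
        nth_rw 1 [← act_inv_of_covariant hj s.unop 1]
        rw [← map_mul, map_mul_map_one, act_inv_of_covariant hj]⟩⟩
  map_one' := Subtype.ext <| by
    change single γ (toEnv 1)⁻¹ (j 1) = single γ 1 (j 1)
    rw [map_one, inv_one]
  map_mul' s t := Subtype.ext <| by
    change single γ (toEnv (t.unop * s.unop))⁻¹ (j 1) =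
      single γ (toEnv s.unop)⁻¹ (j 1) * single γ (toEnv t.unop)⁻¹ (j 1)
    rw [single_mul_single, map_mul, mul_inv_rev]
    nth_rw 2 [← act_inv_of_covariant hj s.unop 1]
    rw [← map_mul, map_mul_map_one, act_inv_of_covariant hj]

/-- The elements `e · s · e = γ_s(e) s` of the corner. -/
def cornerPlus (hj : ∀ s a, γ (toEnv s) (j a) = j (α s a)) : S →* CovCorner γ j where
  toFun s := ⟨single γ (toEnv s) (j (α s 1)),
    (single_mem_corner_iff (isIdempotentElem_map_one j)).mpr
      ⟨map_one_mul_map j _, by rw [hj, ← map_mul, ← map_mul, mul_one]⟩⟩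
  map_one' := Subtype.ext <| by
    change single γ (toEnv 1) (j (α 1 1)) = single γ 1 (j 1)
    rw [map_one, act_one]
  map_mul' s t := Subtype.ext <| by
    change single γ (toEnv (s * t)) (j (α (s * t) 1)) =
      single γ (toEnv s) (j (α s 1)) * single γ (toEnv t) (j (α t 1))
    rw [single_mul_single, hj, ← map_mul toEnv, act_mul, ← map_mul j, ← map_mul (α s), one_mul]

/-- Each defining relation becomes an identity of monomials that follows from covariance, for
instance `s₋ s₊ ↦ e γ_s⁻¹(γ_s(e)) = e` and `s₊ s₋ ↦ γ_s(e)·1`. -/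
theorem exists_toCorner (hj : ∀ s a, γ (toEnv s) (j a) = j (α s a)) :
    ∃ F : FSMR α →+* CovCorner γ j, (∀ a, F (phi α a) = cornerCoef γ j a) ∧
      (∀ s, F (sm α s) = cornerMinus hj (.op s)) ∧ ∀ s, F (sp α s) = cornerPlus hj s := by
  refine (existsUnique_lift α (cornerCoef γ j) (cornerMinus hj) (cornerPlus hj)
    (fun t a => Subtype.ext ?_) (fun s a => Subtype.ext ?_) (fun s => Subtype.ext ?_)
    fun s => Subtype.ext ?_).exists
  · change single γ (toEnv t) (j (α t 1)) * single γ 1 (j a) =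
      single γ 1 (j (α t a)) * single γ (toEnv t) (j (α t 1))
    rw [single_mul_single, single_one_mul_single, mul_one, hj, ← map_mul, ← map_mul, ← map_mul,
      ← map_mul, one_mul, mul_one]
  · change single γ 1 (j a) * single γ (toEnv s)⁻¹ (j 1) =
      single γ (toEnv s)⁻¹ (j 1) * single γ 1 (j (α s a))
    rw [single_one_mul_single, single_mul_single, mul_one, act_inv_of_covariant hj,
      map_one_mul_map, map_mul_map_one]
  · change single γ (toEnv s)⁻¹ (j 1) * single γ (toEnv s) (j (α s 1)) = single γ 1 (j 1)
    rw [single_mul_single, inv_mul_cancel, act_inv_of_covariant hj, map_one_mul_map]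
  · change single γ (toEnv s) (j (α s 1)) * single γ (toEnv s)⁻¹ (j 1) = single γ 1 (j (α s 1))
    rw [single_mul_single, mul_inv_cancel, hj, ← map_mul, ← map_mul, one_mul]

/-- The homomorphism `S^op *_α A *_α S → e(D *_γ G)e` given by a covariant map `j : A → D`. -/
def toCorner (hj : ∀ s a, γ (toEnv s) (j a) = j (α s a)) : FSMR α →+* CovCorner γ j :=
  (exists_toCorner hj).choose

theorem toCorner_phi (hj : ∀ s a, γ (toEnv s) (j a) = j (α s a)) (a : A) :
    (toCorner hj (phi α a)).1 = single γ 1 (j a) :=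
  congrArg Subtype.val ((exists_toCorner hj).choose_spec.1 a)

theorem toCorner_frac (hj : ∀ s a, γ (toEnv s) (j a) = j (α s a)) (s t : S) (a : A) :
    (toCorner hj (sm α s * phi α a * sp α t)).1 =
      single γ ((toEnv s)⁻¹ * toEnv t) (γ (toEnv s)⁻¹ (j (α s 1 * a * α t 1))) := by
  obtain ⟨h1, h2, h3⟩ := (exists_toCorner hj).choose_spec
  rw [toCorner, map_mul, map_mul, h1, h2, h3]
  change single γ (toEnv s)⁻¹ (j 1) * single γ 1 (j a) * single γ (toEnv t) (j (α t 1)) = _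
  rw [single_mul_single, single_mul_single, mul_one, mul_assoc, ← map_mul, ← map_mul,
    map_one_mul_act_inv hj, ← mul_assoc]

/-- A vanishing image means that `j` kills the truncated coefficient, hence some `α_c` does;
expanding the fraction by `c` makes it zero. -/
theorem eq_zero_of_toCorner_eq_zero (hj : ∀ s a, γ (toEnv s) (j a) = j (α s a))
    (hker : ∀ a, j a = 0 → ∃ s, α s a = 0) {g : EnvelopingGroup S} {x : FSMR α}
    (hx : x ∈ component α g) (h : toCorner hj x = 0) : x = 0 := by
  obtain ⟨s, t, a, rfl, rfl⟩ := hx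
  have h' := (toCorner_frac hj s t a).symm.trans (congrArg Subtype.val h)
  have h0 : γ (toEnv s)⁻¹ (j (α s 1 * a * α t 1)) = 0 :=
    single_injective γ _ (h'.trans (single_zero γ _).symm)
  obtain ⟨c, hc⟩ := hker _ ((map_eq_zero_iff _ (RingEquiv.injective _)).mp h0)
  rw [frac_eq_phi, expand α c, hc, map_zero, mul_zero, zero_mul]

theorem map_component_toCorner (hj : ∀ s a, γ (toEnv s) (j a) = j (α s a))
    (hcov : ∀ d, ∃ s a, d = γ (toEnv s)⁻¹ (j a)) (g : EnvelopingGroup S) :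
    (component α g).map (toCorner hj : FSMR α →+ CovCorner γ j) =
      cornerComponent (isIdempotentElem_single γ (isIdempotentElem_map_one j)) g := by
  ext x
  constructor
  · rintro ⟨_, ⟨s, t, a, rfl, rfl⟩, rfl⟩
    exact ⟨_, toCorner_frac hj s t a⟩
  · rintro ⟨c, hc⟩
    have hmem := x.2
    rw [hc, single_mem_corner_iff (isIdempotentElem_map_one j)] at hmem
    obtain ⟨u, b, rfl⟩ := hcov c
    obtain ⟨s, t, rfl⟩ := exists_frac g
    -- A common denominator `k s = l u` for the degree `s⁻¹t` and the coefficient `γ_u⁻¹(j(b))`.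
    obtain ⟨k, l, hkl⟩ := ore s u
    have hb : γ (toEnv u)⁻¹ (j b) = γ (toEnv (k * s))⁻¹ (j (α l b)) := by
      rw [hkl, map_mul, mul_inv_rev, map_mul, RingAut.mul_apply, act_inv_of_covariant hj]
    have hg : (toEnv s)⁻¹ * toEnv t = (toEnv (k * s))⁻¹ * toEnv (k * t) := by
      rw [map_mul, map_mul]; group
    rw [hb, hg, map_one_mul_act_inv hj, act_inv_mul_act_map_one hj] at hmem
    -- Membership in the corner now says that `α_l(b)` is unchanged under `j` by truncation with
    -- `α_{ks}(1)` and `α_{kt}(1)`, so it serves as the coefficient of a preimage.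
    refine ⟨_, ⟨k * s, k * t, α l b, hg.symm, rfl⟩, Subtype.ext ?_⟩
    refine (toCorner_frac hj _ _ _).trans ?_
    rw [hc, hb, hg, map_mul j, (γ _).injective hmem.1, ← map_mul, hmem.2]

theorem isGrading_component_and_toCorner_bijective (hj : ∀ s a, γ (toEnv s) (j a) = j (α s a))
    (hker : ∀ a, j a = 0 → ∃ s, α s a = 0) (hcov : ∀ d, ∃ s a, d = γ (toEnv s)⁻¹ (j a)) :
    IsGrading (component α) ∧ Function.Bijective (toCorner hj) := by
  classical
  have h := isInternal_and_bijective_of_map_eq (toCorner hj : FSMR α →+ CovCorner γ j)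
    (iSup_component α) (isInternal_cornerComponent (isIdempotentElem_map_one j))
    (map_component_toCorner hj hcov) fun g x hx h => eq_zero_of_toCorner_eq_zero hj hker hx h
  refine ⟨⟨⟨1, 1, 1, by simp, by simp [sm_one, sp_one]⟩,
    fun _ _ _ _ => mul_mem_component α, ?_⟩, h.2⟩
  convert h.1

end Covariant

/-! ### The kernel of `j` and the exhaustion of `S⁻¹B`. -/

section Injectivity

variable {A : Type u} [Ring A] {S : Type v} [Monoid S] [IsCancelMul S]
  [OreSet (⊤ : Submonoid S)] (α : S →* (A →ₙ+* A))

/-- The kernel of `φ : A → S^op *_α A *_α S` is contained in `I`. -/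
theorem exists_act_eq_zero_of_phi_eq_zero {a : A} (h : phi α a = 0) : ∃ s, α s a = 0 := by
  -- The covariant map is `a ↦ [1, a]` into `S⁻¹A`, formed from `α` itself without passing to `A/I`.
  have h' := toCorner_phi (Dil.act_toEnv_of α) a
  rw [h, map_zero] at h'
  exact (Dil.of_eq_zero_iff α).mp
    (SkewGroupRing.single_injective _ 1 (h'.symm.trans (SkewGroupRing.single_zero _ _).symm))

theorem quotAct_mk (s : S) (a : A) : quotAct α s (Ideal.Quotient.mk (kerIdeal α) a) =
    Ideal.Quotient.mk (kerIdeal α) (α s a) := rfl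

/-- Passing to `A/I` makes the action injective: if `α_t` kills `α_s(a)`, then `α_{ts}` kills `a`.
-/
theorem eq_zero_of_quotAct_eq_zero {s : S} {x : A ⧸ kerIdeal α} (h : quotAct α s x = 0) :
    x = 0 := by
  obtain ⟨a, rfl⟩ := Ideal.Quotient.mk_surjective x
  rw [quotAct_mk, Ideal.Quotient.eq_zero_iff_mem, mem_kerIdeal] at h
  obtain ⟨t, h⟩ := h
  exact Ideal.Quotient.eq_zero_iff_mem.mpr ((mem_kerIdeal α).mpr ⟨t * s, by rw [act_mul, h]⟩)

theorem sasAct_toSAS (s : S) (a : A) : sasAct α s (toSAS α a) = toSAS α (α s a) :=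
  Subtype.ext (sp_phi_sm α s a)

/-- If `j(a) = 0`, some `φ(α'_s(a + I))` vanishes, so some `α'_t` kills `α'_s(a + I)`; injectivity
of `α'`, used twice, gives `a ∈ I`. -/
theorem toDilated_eq_zero_iff (a : A) : toDilated α a = 0 ↔ a ∈ kerIdeal α := by
  constructor
  · intro h
    obtain ⟨s, h⟩ := (Dil.of_eq_zero_iff _).mp h
    have h1 : phi (quotAct α) (quotAct α s (Ideal.Quotient.mk _ a)) = 0 :=
      congrArg Subtype.val ((sasAct_toSAS (quotAct α) s _).symm.trans h)
    obtain ⟨t, h2⟩ := exists_act_eq_zero_of_phi_eq_zero _ h1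
    exact Ideal.Quotient.eq_zero_iff_mem.mp
      (eq_zero_of_quotAct_eq_zero α (eq_zero_of_quotAct_eq_zero α h2))
  · intro h
    change Dil.of _ (toSAS (quotAct α) (Ideal.Quotient.mk (kerIdeal α) a)) = 0
    rw [Ideal.Quotient.eq_zero_iff_mem.mpr h, map_zero, map_zero]

theorem act_toDilated (s : S) (a : A) :
    Dil.act (sasAct (quotAct α)) (toEnv s) (toDilated α a) = toDilated α (α s a) := by
  refine (Dil.act_toEnv_of _ s _).trans (congrArg (Dil.of _) ?_)
  exact sasAct_toSAS (quotAct α) s _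

theorem exists_eq_act_inv_toDilated (d : DilatedRing α) :
    ∃ s a, d = Dil.act (sasAct (quotAct α)) (toEnv s)⁻¹ (toDilated α a) := by
  induction d using Dil.ind with | _ s b =>
  obtain ⟨_, t, x, rfl⟩ := b
  obtain ⟨a, rfl⟩ := Ideal.Quotient.mk_surjective x
  -- Expanding `[s, t₋ φ(a) t₊]` by `t` gives `[ts, t₊ t₋ φ(a) t₊ t₋]`, and `t₊ t₋ = φ(α_t(1))`,
  -- with coefficients read in `A/I`.
  refine ⟨t * s, α t 1 * a * α t 1, ?_⟩
  change _ = Dil.act (sasAct (quotAct α)) (toEnv (t * s))⁻¹ (Dil.mk _ 1 (toSAS (quotAct α) _))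
  rw [Dil.act_inv_toEnv_mk, one_mul, Dil.mk_expand t]
  refine congrArg (Dil.mk _ _) (Subtype.ext ?_)
  change sp _ t * (sm _ t * phi _ _ * sp _ t) * sm _ t =
    phi (quotAct α) (Ideal.Quotient.mk (kerIdeal α) _)
  have h : phi (quotAct α) (Ideal.Quotient.mk (kerIdeal α) (α t 1)) = sp _ t * sm _ t :=
    (sp_sm (quotAct α) t).symm
  rw [map_mul, map_mul, map_mul, map_mul, h]
  simp only [mul_assoc]

end Injectivity

end

end FracSkew

open FracSkew in
theorem theorem3p9 {A : Type*} [Ring A] {S : Type*} [Monoid S] [IsCancelMul S]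
    [OreLocalization.OreSet (⊤ : Submonoid S)] (α : S →* (A →ₙ+* A)) :
    ∃ γ : EnvelopingGroup S →* RingAut (DilatedRing α),
      -- `γ` extends `α`, through the embedding of `A/I`
      ((∀ a : A, toDilated α a = 0 ↔ a ∈ kerIdeal α) ∧
        ∀ (s : S) (a : A), γ (toEnv s) (toDilated α a) = toDilated α (α s a)) ∧
      ∃ (e : DilatedRing α) (he : IsIdempotentElem e),
        (kerIdeal α ≠ ⊤ → e ≠ 0) ∧
        -- `γ_s(e) ≤ e` in the order of idempotents
        (∀ s : S, γ (toEnv s) e = e * γ (toEnv s) e ∧ γ (toEnv s) e = γ (toEnv s) e * e) ∧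
        -- the two gradings, and a ring isomorphism that carries one onto the other
        IsGrading (component α) ∧
        IsGrading (SkewGroupRing.cornerComponent
          (SkewGroupRing.isIdempotentElem_single γ he)) ∧
        ∃ Ψ : FSMR α ≃+* (SkewGroupRing.isIdempotentElem_single γ he).Corner,
          ∀ g : EnvelopingGroup S, (component α g).map (Ψ : FSMR α →+ _) =
            SkewGroupRing.cornerComponent (SkewGroupRing.isIdempotentElem_single γ he) g := by
  have hj := act_toDilated α
  have hcov := exists_eq_act_inv_toDilated α
  obtain ⟨hgr, hbij⟩ := isGrading_component_and_toCorner_bijective hj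
    (fun a h => (mem_kerIdeal α).mp ((toDilated_eq_zero_iff α a).mp h)) hcov
  -- The idempotent is `e = j(1)`: it vanishes only if `1 ∈ I`, and `γ_s(e) = j(α_s(1))` lies below
  -- it.
  refine ⟨Dil.act (sasAct (quotAct α)), ⟨toDilated_eq_zero_iff α, hj⟩, toDilated α 1,
    isIdempotentElem_map_one _, fun hI he => ?_, fun s => ?_, hgr,
    SkewGroupRing.isGrading_cornerComponent (isIdempotentElem_map_one _),
    RingEquiv.ofBijective (toCorner hj) hbij,
    map_component_toCorner hj hcov⟩
  · exact hI ((Ideal.eq_top_iff_one _).mpr ((toDilated_eq_zero_iff α 1).mp he))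
  · rw [hj, map_one_mul_map, map_mul_map_one]
    exact ⟨rfl, rfl⟩
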